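/- Let $k$ be an algebraically closed field of characteristic zero, let $\gamma\ge 2$, and let $B$ be the smooth projective model of the affine curve $y^2=f(x)$, where $f\in k[x]$ is monic and separable of degree $2\gamma+1$ (an odd hyperelliptic curve of genus $\gamma$). Let $q$ be the unique point of $B$ over $x=\infty$, let $\iota$ be the hyperelliptic involution $(x,y)\mapsto(x,-y)$, and let $\operatorname{Jac}(B)$ be the group of divisors of degree zero modulo principal divisors. For $d\ge 0$ let $\Theta_d\subset\operatorname{Jac}(B)$ be the set of all classes $[p_1+\dots+p_d-dq]$ with $p_i\in B$, and put $\Theta_d^0=\Theta_d\setminus\Theta_{d-1}$ (with $\Theta_{-1}=\emptyset$). A divisor on $B$ is called reduced if it has the form $p_1+\dots+p_n-nq$ with $n\le\gamma$, all $p_i\ne q$, and $p_j\neq\iota(p_i)$ for all $i\ne j$. Fix a point $p\ne q$ of $B$. For every integer $j\ge1$ there is a unique integer $\varepsilon_j\ge 0$ with $j[p-q]\in\Theta^0_{\varepsilon_j}$, and the class $j[p-q]$ contains a unique reduced divisor $R_j(p)$. These satisfy: 1. for every $j\ge1$, $\varepsilon_j>\varepsilon_{j+1}$ if and only if $\iota(p)$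 lies in the support of $R_j(p)$; 2. for every $j\ge1$, $|\varepsilon_j-\varepsilon_{j+1}|\le1$; 3. for every $j\ge1$, if $\varepsilon_j<\gamma$ then $\varepsilon_j\ne\varepsilon_{j+1}$; 4. for every $j\ge1$, if $\varepsilon_{j+1}=\varepsilon_j+1=\varepsilon_{j+2}+1$, then $\varepsilon_j=\varepsilon_2=0$. -/

import Mathlib

open Polynomial IsDedekindDomain
open scoped Polynomial nonZeroDivisors

noncomputable section

/-- An odd hyperelliptic curve of genus `γ` over `k`: the smooth projective model of the affine
curve `y² = f(x)`, where `f` is monic and separable of degree `2γ + 1`. The smooth model has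
exactly one point outside of the affine curve; it is a Weierstrass point. -/
structure OddHyperellipticCurve (k : Type*) [Field k] (γ : ℕ) where
  f : k[X]
  monic : f.Monic
  separable : f.Separable
  natDegree_eq : f.natDegree = 2 * γ + 1

namespace OddHyperellipticCurve

variable {k : Type*} [Field k] {γ : ℕ} (C : OddHyperellipticCurve k γ)

/-! ### Points and the hyperelliptic involution -/

/-- The points of the affine curve `y² = f(x)`. -/
@[ext]
structure AffinePoint where
  x : k
  y : k
  equation : y ^ 2 = C.f.eval x

/-- The points of the smooth projective model: the affine points and the point over `∞`. -/
inductive Point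
  | affine (P : C.AffinePoint) : Point
  | infty : Point

/-- The hyperelliptic involution `(x, y) ↦ (x, -y)`, which fixes the point over `∞`. -/
def iota : C.Point → C.Point
  | .affine P => .affine ⟨P.x, -P.y, by rw [neg_sq, P.equation]⟩
  | .infty => .infty

/-! ### The coordinate ring of the affine curve -/

/-- The polynomial `Y² - f(X)`, as a polynomial in `Y` over `k[X]`. -/
def equationPoly : k[X][X] := X ^ 2 - Polynomial.C C.f

/-- The coordinate ring `k[X, Y] / (Y² - f(X))` of the affine curve. -/
abbrev CoordinateRing : Type _ := AdjoinRoot C.equationPoly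

/-- The function field of the curve. -/
abbrev FunctionField : Type _ := FractionRing C.CoordinateRing

theorem equationPoly_monic : C.equationPoly.Monic :=
  monic_X_pow_sub_C _ two_ne_zero

theorem natDegree_equationPoly : C.equationPoly.natDegree = 2 :=
  natDegree_X_pow_sub_C

theorem not_isSquare_f (z : k[X]) : z ^ 2 ≠ C.f := by
  intro h
  have := congrArg natDegree h
  rw [natDegree_pow, C.natDegree_eq] at this
  omega

theorem irreducible_equationPoly : Irreducible C.equationPoly := by
  rw [C.equationPoly_monic.irreducible_iff_roots_eq_zero_of_degree_le_three
    (by rw [natDegree_equationPoly]) (by rw [natDegree_equationPoly]; omega)]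
  refine Multiset.eq_zero_of_forall_notMem fun z hz => ?_
  have h := (mem_roots'.1 hz).2
  simp only [equationPoly, IsRoot, eval_sub, eval_pow, eval_X, eval_C, sub_eq_zero] at h
  exact C.not_isSquare_f z h

instance : IsDomain C.CoordinateRing :=
  AdjoinRoot.isDomain_of_prime C.irreducible_equationPoly.prime

/-- The function `y` on the affine curve. -/
def yFun : C.CoordinateRing := AdjoinRoot.root C.equationPoly

theorem yFun_sq : C.yFun ^ 2 = algebraMap k[X] C.CoordinateRing C.f := by
  have h := AdjoinRoot.eval₂_root C.equationPoly
  have h' : eval₂ (AdjoinRoot.of C.equationPoly) (AdjoinRoot.root C.equationPoly)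
      (X ^ 2 - Polynomial.C C.f) = 0 := h
  rw [eval₂_sub, eval₂_pow, eval₂_X, eval₂_C, sub_eq_zero] at h'
  exact h'

instance : Module.Finite k[X] C.CoordinateRing := C.equationPoly_monic.finite_adjoinRoot

instance : Module.Free k[X] C.CoordinateRing := C.equationPoly_monic.free_adjoinRoot

instance : FaithfulSMul k[X] C.CoordinateRing := by
  infer_instance

instance : FaithfulSMul k[X] C.FunctionField := .trans k[X] C.CoordinateRing _

/-- The function field as an extension of `k(x)`. -/
instance : Algebra (RatFunc k) C.FunctionField := RatFunc.liftAlgebra k C.FunctionField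

instance : IsScalarTower k[X] (RatFunc k) C.FunctionField :=
  RatFunc.isScalarTower_liftAlgebra k C.FunctionField

theorem exists_eq_add_mul_yFun (g : C.CoordinateRing) :
    ∃ a b : k[X], g = algebraMap k[X] _ a + algebraMap k[X] _ b * C.yFun := by
  obtain ⟨p, rfl⟩ := AdjoinRoot.mk_surjective g
  refine ⟨(p %ₘ C.equationPoly).coeff 0, (p %ₘ C.equationPoly).coeff 1, ?_⟩
  have hne : C.equationPoly ≠ 1 := by
    intro h
    have := C.natDegree_equationPoly
    rw [h, natDegree_one] at this
    omega
  have hdeg : (p %ₘ C.equationPoly).natDegree < 2 :=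
    (natDegree_modByMonic_lt p C.equationPoly_monic hne).trans_eq C.natDegree_equationPoly
  have h1 : AdjoinRoot.mk C.equationPoly p = AdjoinRoot.mk C.equationPoly (p %ₘ C.equationPoly) := by
    conv_lhs => rw [← modByMonic_add_div p C.equationPoly]
    simp
  rw [h1]
  conv_lhs => rw [as_sum_range' _ 2 hdeg]
  simp only [Finset.sum_range_succ, Finset.sum_range_zero, zero_add, map_add,
    ← C_mul_X_pow_eq_monomial, pow_zero, mul_one, pow_one, map_mul, AdjoinRoot.mk_X]
  rfl

theorem squarefree_f : Squarefree C.f := C.separable.squarefree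

theorem dvd_of_isIntegral {m n : k[X]} (hn : n ≠ 0)
    (h : IsIntegral k[X]
      (algebraMap k[X] C.FunctionField m / algebraMap k[X] C.FunctionField n)) : n ∣ m := by
  have h' : IsIntegral k[X] (algebraMap k[X] (RatFunc k) m / algebraMap k[X] (RatFunc k) n) := by
    rw [← isIntegral_algebraMap_iff (algebraMap (RatFunc k) C.FunctionField).injective, map_div₀,
      ← IsScalarTower.algebraMap_apply, ← IsScalarTower.algebraMap_apply]
    exact h
  obtain ⟨u, hu⟩ := IsIntegrallyClosed.isIntegral_iff.1 h'
  have hn' : algebraMap k[X] (RatFunc k) n ≠ 0 :=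
    (map_ne_zero_iff _ (IsFractionRing.injective k[X] (RatFunc k))).2 hn
  rw [eq_div_iff hn', ← map_mul] at hu
  exact ⟨u, by rw [← IsFractionRing.injective k[X] (RatFunc k) hu, mul_comm]⟩

theorem dvd_of_sq_dvd_sq_mul {b c : k[X]} (hc : c ≠ 0) (h : c ^ 2 ∣ b ^ 2 * C.f) : c ∣ b := by
  obtain ⟨b', c', d, hd, hcop, hb, hc'⟩ : ∃ b' c' d : k[X], d ≠ 0 ∧ IsCoprime c' b' ∧
      b = d * b' ∧ c = d * c' := by
    let : GCDMonoid k[X] := UniqueFactorizationMonoid.toGCDMonoid _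
    obtain ⟨b', c', hb, hc', hu⟩ := extract_gcd b c
    refine ⟨b', c', gcd b c, fun h0 => hc ?_, ((gcd_isUnit_iff b' c').1 hu).symm, hb, hc'⟩
    rw [hc', h0, zero_mul]
  subst hb hc'
  have h2 : c' ^ 2 ∣ b' ^ 2 * C.f := by
    rw [mul_pow, mul_pow, mul_assoc] at h
    exact (mul_dvd_mul_iff_left (pow_ne_zero 2 hd)).1 h
  have h3 : c' * c' ∣ C.f := by
    rw [← sq]
    exact (hcop.pow : IsCoprime (c' ^ 2) (b' ^ 2)).dvd_of_dvd_mul_left h2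
  exact mul_dvd_mul_left d ((C.squarefree_f c' h3).dvd)

/-- The conjugation `y ↦ -y` of the coordinate ring. -/
def conj : C.CoordinateRing →ₐ[k[X]] C.CoordinateRing :=
  AdjoinRoot.liftAlgHom C.equationPoly (Algebra.ofId _ _) (-C.yFun) (by
    simp only [equationPoly, eval₂_sub, eval₂_pow, eval₂_X, eval₂_C, neg_sq, yFun_sq]
    exact sub_self _)

theorem conj_yFun : C.conj C.yFun = -C.yFun := by
  simp [conj, yFun]

theorem conj_conj (g : C.CoordinateRing) : C.conj (C.conj g) = g := by
  obtain ⟨a, b, rfl⟩ := C.exists_eq_add_mul_yFun g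
  simp only [map_add, map_mul, AlgHom.commutes, conj_yFun, map_neg, neg_neg]

theorem conj_injective : Function.Injective C.conj :=
  (show Function.LeftInverse C.conj C.conj from C.conj_conj).injective

theorem exists_div (z : C.FunctionField) : ∃ a b c : k[X], c ≠ 0 ∧
    z = (algebraMap k[X] _ a + algebraMap k[X] _ b * algebraMap C.CoordinateRing _ C.yFun) /
      algebraMap k[X] _ c := by
  obtain ⟨g, h, hh, rfl⟩ := IsFractionRing.div_surjective (A := C.CoordinateRing) z
  have hh0 : h ≠ 0 := nonZeroDivisors.ne_zero hh
  have hch0 : C.conj h ≠ 0 := (map_ne_zero_iff _ C.conj_injective).2 hh0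
  obtain ⟨a, b, hab⟩ := C.exists_eq_add_mul_yFun (g * C.conj h)
  obtain ⟨r, s, hrs⟩ := C.exists_eq_add_mul_yFun h
  have hN : h * C.conj h = algebraMap k[X] _ (r ^ 2 - s ^ 2 * C.f) := by
    rw [hrs]
    simp only [map_add, map_mul, AlgHom.commutes, conj_yFun, map_sub, map_pow, ← yFun_sq]
    ring
  refine ⟨a, b, r ^ 2 - s ^ 2 * C.f, ?_, ?_⟩
  · intro h0
    rw [h0, map_zero] at hN
    exact mul_ne_zero hh0 hch0 hN
  · rw [IsScalarTower.algebraMap_apply k[X] C.CoordinateRing C.FunctionField a,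
      IsScalarTower.algebraMap_apply k[X] C.CoordinateRing C.FunctionField b,
      IsScalarTower.algebraMap_apply k[X] C.CoordinateRing C.FunctionField (_ - _),
      ← map_mul, ← map_add, ← hab, ← hN, map_mul, map_mul, mul_div_mul_right]
    exact (map_ne_zero_iff _ (IsFractionRing.injective _ _)).2 hch0

instance : Module.Finite (RatFunc k) C.FunctionField := by
  refine ⟨⟨{1, algebraMap C.CoordinateRing _ C.yFun}, eq_top_iff.2 fun z _ => ?_⟩⟩
  obtain ⟨a, b, c, hc, rfl⟩ := C.exists_div z
  rw [Finset.coe_insert, Finset.coe_singleton, Submodule.mem_span_pair]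
  refine ⟨algebraMap k[X] _ a / algebraMap k[X] _ c, algebraMap k[X] _ b / algebraMap k[X] _ c, ?_⟩
  simp only [Algebra.smul_def, map_div₀, ← IsScalarTower.algebraMap_apply]
  ring

theorem isIntegrallyClosed_coordinateRing (h2 : (2 : k) ≠ 0) :
    IsIntegrallyClosed C.CoordinateRing := by
  refine (isIntegrallyClosed_iff C.FunctionField).2 fun {z} hz => ?_
  have hz : IsIntegral k[X] z := isIntegral_trans z hz
  obtain ⟨a, b, c, hc, hzabc⟩ := C.exists_div z
  let σ : C.FunctionField →ₐ[k[X]] C.FunctionField :=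
    IsFractionRing.liftAlgHom (K := C.FunctionField)
      (g := (Algebra.algHom k[X] C.CoordinateRing C.FunctionField).comp C.conj)
      ((IsFractionRing.injective C.CoordinateRing C.FunctionField).comp C.conj_injective)
  have hσy : σ (algebraMap _ _ C.yFun) = - algebraMap _ _ C.yFun := by
    have h := IsFractionRing.lift_algebraMap (K := C.FunctionField)
      (g := ((Algebra.algHom k[X] C.CoordinateRing C.FunctionField).comp C.conj).toRingHom)
      ((IsFractionRing.injective C.CoordinateRing C.FunctionField).comp C.conj_injective) C.yFun
    refine h.trans ?_
    change algebraMap C.CoordinateRing C.FunctionField (C.conj C.yFun) = _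
    rw [conj_yFun, map_neg]
  have hσz : IsIntegral k[X] (σ z) := hz.map σ
  have h2' : IsUnit (2 : k[X]) := by
    rw [← map_ofNat (Polynomial.C : k →+* k[X]) 2]
    exact isUnit_C.2 (IsUnit.mk0 _ h2)
  set y := algebraMap C.CoordinateRing C.FunctionField C.yFun
  have hy : y ^ 2 = algebraMap k[X] _ C.f := by
    rw [← map_pow, yFun_sq, ← IsScalarTower.algebraMap_apply]
  have hσz' : σ z = (algebraMap k[X] _ a - algebraMap k[X] _ b * y) / algebraMap k[X] _ c := by
    rw [hzabc, map_div₀, map_add, map_mul, hσy]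
    simp [sub_eq_add_neg]
  have ha : c ∣ a := by
    have := C.dvd_of_isIntegral (m := 2 * a) hc (by
      have e : algebraMap k[X] C.FunctionField (2 * a) / algebraMap k[X] C.FunctionField c =
          z + σ z := by
        rw [hσz', hzabc, map_mul, map_ofNat]
        ring
      rw [e]
      exact hz.add hσz)
    exact (h2'.dvd_mul_left).1 this
  have hb : c ∣ b := by
    have := C.dvd_of_isIntegral (m := 2 ^ 2 * (b ^ 2 * C.f)) (pow_ne_zero 2 hc) (by
      have e : algebraMap k[X] C.FunctionField (2 ^ 2 * (b ^ 2 * C.f)) /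
          algebraMap k[X] C.FunctionField (c ^ 2) = (z - σ z) ^ 2 := by
        rw [hσz', hzabc]
        simp only [map_mul, map_pow, ← hy, map_ofNat]
        ring
      rw [e]
      exact (hz.sub hσz).pow 2)
    exact C.dvd_of_sq_dvd_sq_mul hc (((h2'.pow 2).dvd_mul_left).1 this)
  obtain ⟨a, rfl⟩ := ha
  obtain ⟨b, rfl⟩ := hb
  refine ⟨algebraMap k[X] _ a + algebraMap k[X] _ b * C.yFun, ?_⟩
  have hc' : algebraMap k[X] C.FunctionField c ≠ 0 := by
    simpa using hc
  rw [hzabc, eq_div_iff hc', map_add, map_mul, map_mul, map_mul,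
    ← IsScalarTower.algebraMap_apply, ← IsScalarTower.algebraMap_apply]
  ring

theorem yFun_equation (P : C.AffinePoint) :
    eval₂ (evalRingHom P.x) P.y C.equationPoly = 0 := by
  rw [equationPoly, eval₂_sub, eval₂_pow, eval₂_X, eval₂_C, coe_evalRingHom, P.equation, sub_self]

variable {C}

/-- Evaluation of regular functions at an affine point. -/
def AffinePoint.evalHom (P : C.AffinePoint) : C.CoordinateRing →+* k :=
  AdjoinRoot.lift (evalRingHom P.x) P.y (C.yFun_equation P)

variable [CharZero k]

instance : IsDedekindDomain C.CoordinateRing :=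
  haveI : IsIntegrallyClosed C.CoordinateRing := C.isIntegrallyClosed_coordinateRing two_ne_zero
  haveI : Ring.DimensionLEOne C.CoordinateRing := Ring.DimensionLEOne.of_isIntegral k[X] _
  { }

/-- The maximal ideal of an affine point: the regular functions that vanish at the point. -/
def AffinePoint.place (P : C.AffinePoint) : HeightOneSpectrum C.CoordinateRing where
  asIdeal := RingHom.ker P.evalHom
  isPrime := RingHom.ker_isPrime _
  ne_bot := by
    intro h
    have hmem : algebraMap k[X] C.CoordinateRing (X - Polynomial.C P.x) ∈
        RingHom.ker P.evalHom := by
      rw [RingHom.mem_ker, AdjoinRoot.algebraMap_eq, AffinePoint.evalHom, AdjoinRoot.lift_of]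
      simp
    rw [h, Ideal.mem_bot, map_eq_zero_iff _ (FaithfulSMul.algebraMap_injective _ _)] at hmem
    exact X_sub_C_ne_zero _ hmem

/-! ### Orders of vanishing, divisors and the Jacobian -/

/-- The order of vanishing of a nonzero rational function at a point. At an affine point it is
the normalized discrete valuation of the maximal ideal of that point. The point over `∞` is the
only place of the function field over the place `∞` of `k(x)`, and its residue field is `k`, so
that the order of `h` there is the order at `∞`, that is minus the degree, of the norm of `h`
in `k(x)`. Thus `a(x) + b(x) y` has a pole of order `max (2 deg a) (2 deg b + 2γ + 1)` there. -/
def ord : C.Point → C.FunctionField → ℤ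
  | .affine P, h => -WithZero.log (P.place.valuation C.FunctionField h)
  | .infty, h => -(Algebra.norm (RatFunc k) h).intDegree

theorem ord_one (P : C.Point) : ord P 1 = 0 := by
  cases P <;> simp [ord]

theorem ord_mul (P : C.Point) {g h : C.FunctionField} (hg : g ≠ 0) (hh : h ≠ 0) :
    ord P (g * h) = ord P g + ord P h := by
  cases P with
  | affine P =>
    rw [ord, map_mul, WithZero.log_mul ((Valuation.ne_zero_iff _).2 hg)
      ((Valuation.ne_zero_iff _).2 hh), neg_add]
    rfl
  | infty =>
    have hg' : Algebra.norm (RatFunc k) g ≠ 0 := Algebra.norm_ne_zero_iff.2 hg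
    have hh' : Algebra.norm (RatFunc k) h ≠ 0 := Algebra.norm_ne_zero_iff.2 hh
    rw [ord, map_mul, RatFunc.intDegree_mul hg' hh', neg_add]
    rfl

theorem ord_inv (P : C.Point) {g : C.FunctionField} (hg : g ≠ 0) : ord P g⁻¹ = -ord P g := by
  have h := ord_mul P hg (inv_ne_zero hg)
  rw [mul_inv_cancel₀ hg, ord_one] at h
  omega

variable (C)

/-- Divisors on the curve: formal integral combinations of points. -/
abbrev Divisor : Type _ := C.Point →₀ ℤ

/-- The degree of a divisor. -/
def degree : C.Divisor →+ ℤ := Finsupp.degree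

/-- The group of divisors of degree zero. -/
abbrev DivisorZero : AddSubgroup C.Divisor := C.degree.ker

/-- The group of principal divisors. -/
def principal : AddSubgroup C.Divisor where
  carrier := {D | ∃ h : C.FunctionField, h ≠ 0 ∧ ∀ P, D P = ord P h}
  zero_mem' := ⟨1, one_ne_zero, fun P => (ord_one P).symm⟩
  add_mem' := by
    rintro D E ⟨g, hg, hD⟩ ⟨h, hh, hE⟩
    exact ⟨g * h, mul_ne_zero hg hh, fun P => by
      rw [Finsupp.add_apply, hD, hE, ord_mul P hg hh]⟩
  neg_mem' := by
    rintro D ⟨g, hg, hD⟩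
    exact ⟨g⁻¹, inv_ne_zero hg, fun P => by rw [Finsupp.neg_apply, hD, ord_inv P hg]⟩

/-- The (group of `k`-points of the) Jacobian: divisors of degree zero modulo linear
equivalence. -/
abbrev Jac : Type _ := C.DivisorZero ⧸ C.principal.addSubgroupOf C.DivisorZero

/-- The class of a divisor of degree zero in the Jacobian. -/
def divisorClass : C.DivisorZero →+ C.Jac :=
  QuotientAddGroup.mk' _

/-- The divisor `p - q`, where `q` is the point over `∞`. -/
def pointDivisor (p : C.Point) : C.DivisorZero :=
  ⟨Finsupp.single p 1 - Finsupp.single .infty 1, by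
    simp [degree, AddMonoidHom.mem_ker]⟩

/-- The point class `[p - q]`, where `q` is the point over `∞`. -/
def pointClass (p : C.Point) : C.Jac := C.divisorClass (C.pointDivisor p)

/-! ### Theta strata and multiplication profiles -/

/-- The `d`-th Abel–Jacobi map `(p₁, …, p_d) ↦ [p₁ + ⋯ + p_d - d q]`. -/
def abelJacobi (d : ℕ) (P : Fin d → C.Point) : C.Jac :=
  C.divisorClass (∑ i, C.pointDivisor (P i))

/-- The locus `Θ_d`: the image of the `d`-th Abel–Jacobi map. -/
def Theta (d : ℕ) : Set C.Jac := Set.range (C.abelJacobi d)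

/-- The stratum `Θ⁰_d = Θ_d \ Θ_{d-1}`, where `Θ_{-1} = ∅`. -/
def ThetaOpen : ℕ → Set C.Jac
  | 0 => C.Theta 0
  | d + 1 => C.Theta (d + 1) \ C.Theta d

/-- The multiplication profile of a class `x`: its `j`-th entry is the unique `d` for which
`j • x` lies in `Θ⁰_d`. -/
def multProfile (x : C.Jac) (j : ℕ) : ℕ := sInf {d | j • x ∈ C.ThetaOpen d}

/-! ### Reduced divisors -/

/-- A divisor is reduced with respect to the point `q` over `∞` if it has the form
`p₁ + ⋯ + pₙ - n q`, where `n ≤ γ`, all `pᵢ` differ from `q`, and no two of the `pᵢ` (for distinct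
indices) are exchanged by the hyperelliptic involution. In particular the Weierstrass points
other than `q` occur with multiplicity at most one. -/
def IsReduced (D : C.Divisor) : Prop :=
  ∃ (n : ℕ) (P : Fin n → C.Point),
    D = ∑ i, Finsupp.single (P i) 1 - Finsupp.single .infty (n : ℤ) ∧
    (∀ i, P i ≠ .infty) ∧ (∀ i j, i ≠ j → P j ≠ C.iota (P i)) ∧ n ≤ γ

end OddHyperellipticCurve

end

noncomputable section

namespace OddHyperellipticCurve

variable {k : Type*} [Field k] {γ : ℕ} {C : OddHyperellipticCurve k γ}

/-! ### The coordinate ring: norms and evaluation -/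

/-! Every class `j[p - q]` is represented by a multiset `M j` of at most `γ` affine points with no
conjugate pair, and `ε_j` is its cardinality. Everything follows from comparing `M j` with `M (j +
1)`.

Existence (`exists_reduction`): the functions `a(x) + b y` with `deg a ≤ γ` and `b` constant form a
space of dimension `γ + 2`, so one of them vanishes on any `γ + 1` given points. It has at most `2γ
+ 1` zeros, which leaves at most `γ` others; applying the involution to these negates their class
and gives back the original one.

Uniqueness (`Semireduced.le_of_affineClass_eq`): if `M ~ N` and `M.card + N.card ≤ 2γ`, then `M +
ι(N)` is the zero divisor of a regular function with a pole of order at most `2γ` at `q`. A nonzero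
`y`-term forces order at least `2γ + 1`, so the function is a polynomial in `x` and its zeros are
symmetric under `ι`. As `M` has no conjugate pair, it must lie inside `N`.

Hence adding `p` either cancels a copy of `ι(p)`, or appends `p` when there is room, or keeps the
cardinality at `γ`. A rise followed at once by a drop means that `ι(p)` lies in `p ::ₘ M j` but not
in `M j`, so `p = ι(p)` and the profile has period two. -/

/-- The function `a(x) + b(x) y` on the affine curve. -/
def linY (C : OddHyperellipticCurve k γ) (a b : k[X]) : C.CoordinateRing :=
  algebraMap k[X] _ a + algebraMap k[X] _ b * C.yFun

theorem algebraMap_eq_linY (a : k[X]) : algebraMap k[X] C.CoordinateRing a = C.linY a 0 := by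
  simp [linY]

/-- The basis `1, y` of the coordinate ring over `k[x]`. -/
def basisY (C : OddHyperellipticCurve k γ) : Module.Basis (Fin 2) k[X] C.CoordinateRing :=
  (AdjoinRoot.powerBasis' C.equationPoly_monic).basis.reindex (finCongr C.natDegree_equationPoly)

theorem basisY_zero : C.basisY 0 = 1 := by
  rw [basisY, Module.Basis.reindex_apply, PowerBasis.coe_basis]
  exact pow_zero _

theorem basisY_one : C.basisY 1 = C.yFun := by
  rw [basisY, Module.Basis.reindex_apply, PowerBasis.coe_basis]
  exact pow_one _

theorem linY_eq_basis (a b : k[X]) : C.linY a b = a • C.basisY 0 + b • C.basisY 1 := by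
  rw [basisY_zero, basisY_one, Algebra.smul_def, Algebra.smul_def, mul_one, linY]

theorem linY_injective {a b a' b' : k[X]} (h : C.linY a b = C.linY a' b') : a = a' ∧ b = b' := by
  rw [linY_eq_basis, linY_eq_basis] at h
  have h0 := congrArg (fun z => C.basisY.repr z 0) h
  have h1 := congrArg (fun z => C.basisY.repr z 1) h
  simp at h0 h1
  exact ⟨h0, h1⟩

theorem linY_eq_zero_iff {a b : k[X]} : C.linY a b = 0 ↔ a = 0 ∧ b = 0 := by
  constructor
  · intro h
    exact linY_injective (h.trans (by simp [linY] : (0 : C.CoordinateRing) = C.linY 0 0))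
  · rintro ⟨rfl, rfl⟩
    simp [linY]

theorem linY_mul_yFun (a b : k[X]) : C.linY a b * C.yFun = C.linY (b * C.f) a := by
  simp only [linY, map_mul, ← yFun_sq]
  ring

theorem norm_linY (a b : k[X]) :
    Algebra.norm k[X] (C.linY a b) = a ^ 2 - b ^ 2 * C.f := by
  have h0 : C.linY a b * C.basisY 0 = a • C.basisY 0 + b • C.basisY 1 := by
    rw [basisY_zero, mul_one, linY_eq_basis, basisY_zero]
  have h1 : C.linY a b * C.basisY 1 = (b * C.f) • C.basisY 0 + a • C.basisY 1 := by
    rw [basisY_one, linY_mul_yFun, linY_eq_basis, basisY_one]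
  rw [Algebra.norm_eq_matrix_det C.basisY, Matrix.det_fin_two]
  simp only [Algebra.leftMulMatrix_eq_repr_mul, h0, h1, map_add, map_smul,
    Module.Basis.repr_self, Finsupp.add_apply, Finsupp.smul_apply, smul_eq_mul]
  simp
  ring

theorem conj_linY (a b : k[X]) : C.conj (C.linY a b) = C.linY a (-b) := by
  simp only [linY, map_add, map_mul, AlgHom.commutes, conj_yFun, map_neg, neg_mul, mul_neg]

theorem mul_conj (g : C.CoordinateRing) :
    g * C.conj g = algebraMap k[X] _ (Algebra.norm k[X] g) := by
  obtain ⟨a, b, rfl⟩ := C.exists_eq_add_mul_yFun g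
  change C.linY a b * C.conj (C.linY a b) = algebraMap k[X] _ (Algebra.norm k[X] (C.linY a b))
  rw [conj_linY, norm_linY]
  simp only [linY, map_neg, map_sub, map_mul, map_pow, ← yFun_sq]
  ring

theorem norm_ne_zero {g : C.CoordinateRing} (hg : g ≠ 0) : Algebra.norm k[X] g ≠ 0 :=
  Algebra.norm_ne_zero_iff.2 hg

/-- The degrees of `a²` and `b² f` have opposite parity, so leading terms cannot cancel. The norm
degree is the pole order at infinity. -/
theorem natDegree_norm_linY_lower (a b : k[X]) (hb : b ≠ 0) :
    2 * γ + 1 ≤ (Algebra.norm k[X] (C.linY a b)).natDegree := by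
  have h2 : (b ^ 2 * C.f).natDegree = 2 * b.natDegree + (2 * γ + 1) := by
    rw [natDegree_mul (pow_ne_zero 2 hb) C.monic.ne_zero, natDegree_pow, C.natDegree_eq]
  have h1 : (a ^ 2).natDegree = 2 * a.natDegree := natDegree_pow a 2
  rw [norm_linY]
  rcases lt_or_ge (a ^ 2).natDegree (b ^ 2 * C.f).natDegree with h | h
  · rw [natDegree_sub_eq_right_of_natDegree_lt h]
    omega
  · rw [natDegree_sub_eq_left_of_natDegree_lt (by omega)]
    omega

theorem natDegree_norm_linY_upper {a b : k[X]} (ha : a.natDegree ≤ γ) (hb : b.natDegree = 0) :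
    (Algebra.norm k[X] (C.linY a b)).natDegree ≤ 2 * γ + 1 := by
  rw [norm_linY]
  refine (natDegree_sub_le _ _).trans (max_le ?_ ?_)
  · rw [natDegree_pow]
    omega
  · refine natDegree_mul_le.trans ?_
    rw [natDegree_pow, C.natDegree_eq, hb]
    omega

theorem evalHom_algebraMap (P : C.AffinePoint) (a : k[X]) :
    P.evalHom (algebraMap k[X] _ a) = a.eval P.x := by
  rw [AdjoinRoot.algebraMap_eq, AffinePoint.evalHom, AdjoinRoot.lift_of]
  rfl

theorem evalHom_yFun (P : C.AffinePoint) : P.evalHom C.yFun = P.y :=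
  AdjoinRoot.lift_root _

theorem evalHom_linY (P : C.AffinePoint) (a b : k[X]) :
    P.evalHom (C.linY a b) = a.eval P.x + b.eval P.x * P.y := by
  simp only [linY, map_add, map_mul, evalHom_algebraMap, evalHom_yFun]

/-- The hyperelliptic involution on affine points. -/
def AffinePoint.inv (P : C.AffinePoint) : C.AffinePoint :=
  ⟨P.x, -P.y, by rw [neg_sq, P.equation]⟩

@[simp] theorem AffinePoint.inv_inv (P : C.AffinePoint) : P.inv.inv = P := by
  ext <;> simp [AffinePoint.inv]

theorem AffinePoint.inv_injective :
    Function.Injective (AffinePoint.inv : C.AffinePoint → C.AffinePoint) :=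
  Function.LeftInverse.injective AffinePoint.inv_inv

theorem evalHom_conj (P : C.AffinePoint) (g : C.CoordinateRing) :
    P.evalHom (C.conj g) = P.inv.evalHom g := by
  obtain ⟨a, b, rfl⟩ := C.exists_eq_add_mul_yFun g
  change P.evalHom (C.conj (C.linY a b)) = P.inv.evalHom (C.linY a b)
  rw [conj_linY, evalHom_linY, evalHom_linY]
  simp [AffinePoint.inv]

theorem evalHom_const (P : C.AffinePoint) (c : k) :
    P.evalHom (algebraMap k C.CoordinateRing c) = c := by
  rw [IsScalarTower.algebraMap_apply k k[X] C.CoordinateRing, evalHom_algebraMap]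
  simp

/-! ### Places of the affine curve -/

theorem mem_place_iff (P : C.AffinePoint) (g : C.CoordinateRing) :
    g ∈ P.place.asIdeal ↔ P.evalHom g = 0 := RingHom.mem_ker

/-- Modulo `y - P.y` a function `a + b y` becomes the polynomial `a + b P.y`, which is divisible by
`x - P.x` once it vanishes at `P.x`. -/
theorem place_eq_span (P : C.AffinePoint) : P.place.asIdeal =
    Ideal.span {algebraMap k[X] _ (X - Polynomial.C P.x),
      C.yFun - algebraMap k C.CoordinateRing P.y} := by
  apply le_antisymm
  · intro g hg
    rw [mem_place_iff] at hg
    obtain ⟨a, b, rfl⟩ := C.exists_eq_add_mul_yFun g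
    change P.evalHom (C.linY a b) = 0 at hg
    rw [evalHom_linY] at hg
    have hr : (a + b * Polynomial.C P.y).IsRoot P.x := by simpa using hg
    obtain ⟨c, hc⟩ := dvd_iff_isRoot.2 hr
    rw [Ideal.mem_span_pair]
    refine ⟨algebraMap k[X] _ c, algebraMap k[X] _ b, ?_⟩
    rw [IsScalarTower.algebraMap_apply k k[X] C.CoordinateRing, Polynomial.algebraMap_eq,
      ← map_mul, mul_comm c, ← hc, map_add, map_mul]
    ring
  · rw [Ideal.span_le, Set.insert_subset_iff, Set.singleton_subset_iff]
    constructor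
    · rw [SetLike.mem_coe, mem_place_iff, evalHom_algebraMap]
      simp
    · rw [SetLike.mem_coe, mem_place_iff, map_sub, evalHom_yFun, evalHom_const, sub_self]

theorem place_injective {P Q : C.AffinePoint} (h : P.place.asIdeal = Q.place.asIdeal) : P = Q := by
  have h1 : algebraMap k[X] C.CoordinateRing (X - Polynomial.C P.x) ∈ P.place.asIdeal := by
    rw [mem_place_iff, evalHom_algebraMap]; simp
  have h2 : C.yFun - algebraMap k C.CoordinateRing P.y ∈ P.place.asIdeal := by
    rw [mem_place_iff, map_sub, evalHom_yFun, evalHom_const, sub_self]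
  rw [h, mem_place_iff, evalHom_algebraMap] at h1
  rw [h, mem_place_iff, map_sub, evalHom_yFun, evalHom_const] at h2
  simp only [eval_sub, eval_X, eval_C] at h1
  exact (AffinePoint.ext (sub_eq_zero.1 h1) (sub_eq_zero.1 h2)).symm

variable [CharZero k]

/-- This is the divisor of `x - P.x` in ideal form. It yields the relation between conjugate points,
the zeros of polynomials in `x`, and the classification of places. -/
theorem span_X_sub_C (P : C.AffinePoint) :
    Ideal.span {algebraMap k[X] C.CoordinateRing (X - Polynomial.C P.x)} =
      P.place.asIdeal * P.inv.place.asIdeal := by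
  obtain ⟨g, hg⟩ : X - Polynomial.C P.x ∣ C.f - Polynomial.C (P.y ^ 2) := by
    rw [dvd_iff_isRoot]
    simp [P.equation]
  set A := C.CoordinateRing
  set t : A := algebraMap k[X] A (X - Polynomial.C P.x) with ht
  set c : A := algebraMap k A P.y with hc
  have hc' : algebraMap k[X] A (Polynomial.C P.y) = c := by
    rw [hc, IsScalarTower.algebraMap_apply k k[X] A, Polynomial.algebraMap_eq]
  have hprod : (C.yFun - c) * (C.yFun + c) = t * algebraMap k[X] A g := by
    rw [ht, ← map_mul, ← hg, map_sub, ← yFun_sq, map_pow, map_pow, hc']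
    ring
  have e1 := place_eq_span P
  have e2 := place_eq_span P.inv
  have e3 : C.yFun - algebraMap k A P.inv.y = C.yFun + c := by
    change C.yFun - algebraMap k A (-P.y) = _
    rw [map_neg, sub_neg_eq_add]
  rw [e3] at e2
  change _ = Ideal.span {t, C.yFun + c} at e2
  change _ = Ideal.span {t, C.yFun - c} at e1
  have m1 : t ∈ P.place.asIdeal := by rw [e1]; exact Ideal.subset_span (by simp)
  have m2 : t ∈ P.inv.place.asIdeal := by rw [e2]; exact Ideal.subset_span (by simp)
  have m3 : C.yFun - c ∈ P.place.asIdeal := by rw [e1]; exact Ideal.subset_span (by simp)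
  have m4 : C.yFun + c ∈ P.inv.place.asIdeal := by rw [e2]; exact Ideal.subset_span (by simp)
  apply le_antisymm
  · rw [Ideal.span_singleton_le_iff_mem]
    set I := P.place.asIdeal * P.inv.place.asIdeal
    have k1 : t * t ∈ I := Ideal.mul_mem_mul m1 m2
    have k2 : t * (C.yFun + c) ∈ I := Ideal.mul_mem_mul m1 m4
    have k3 : t * (C.yFun - c) ∈ I := by rw [mul_comm]; exact Ideal.mul_mem_mul m3 m2
    have k4 : t * algebraMap k[X] A g ∈ I := by rw [← hprod]; exact Ideal.mul_mem_mul m3 m4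
    -- At a Weierstrass point, separability of `f` makes `g` prime to `x - P.x`, so `t * t` and `t *
    -- g` generate `t`. Elsewhere `t` is the difference of `k2` and `k3` divided by `2 P.y`.
    by_cases hy : P.y = 0
    · have hg0 : g.eval P.x ≠ 0 := by
        intro h0
        obtain ⟨g', rfl⟩ := dvd_iff_isRoot.2 h0
        rw [hy, zero_pow two_ne_zero, map_zero, sub_zero, ← mul_assoc] at hg
        have := C.squarefree_f (X - Polynomial.C P.x) ⟨g', hg⟩
        exact not_isUnit_X_sub_C _ this
      obtain ⟨u, v, huv⟩ : IsCoprime (X - Polynomial.C P.x) g := by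
        rw [(irreducible_X_sub_C P.x).coprime_iff_not_dvd, dvd_iff_isRoot]
        exact hg0
      have : t = algebraMap k[X] A u * (t * t) + algebraMap k[X] A v * (t * algebraMap k[X] A g) := by
        have h := congrArg (algebraMap k[X] A) huv
        rw [map_add, map_mul, map_mul, map_one] at h
        change algebraMap k[X] A u * t + _ = 1 at h
        linear_combination (-t) * h
      rw [this]
      exact I.add_mem (I.mul_mem_left _ k1) (I.mul_mem_left _ k4)
    · have h2 : (2 * P.y : k) ≠ 0 := mul_ne_zero two_ne_zero hy
      have hi : algebraMap k A (2 * P.y)⁻¹ * (2 * c) = 1 := by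
        rw [hc, ← map_ofNat (algebraMap k A) 2, ← map_mul, ← map_mul, inv_mul_cancel₀ h2, map_one]
      have : t = algebraMap k A (2 * P.y)⁻¹ * (t * (C.yFun + c) - t * (C.yFun - c)) := by
        linear_combination (-t) * hi
      rw [this]
      exact I.mul_mem_left _ (I.sub_mem k2 k3)
  · rw [e1, e2, Ideal.span_mul_span, Ideal.span_le]
    intro z hz
    obtain ⟨i, hi, j, hj, rfl⟩ := Set.mem_mul.1 hz
    simp only [Set.mem_singleton_iff, Set.mem_insert_iff] at hi hj
    rw [SetLike.mem_coe, Ideal.mem_span_singleton]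
    rcases hi with rfl | rfl
    · exact dvd_mul_right _ _
    · rcases hj with rfl | rfl
      · exact dvd_mul_left _ _
      · exact ⟨_, hprod⟩

/-- The order of vanishing of a regular function at an affine point. -/
def AffinePoint.mult (P : C.AffinePoint) (g : C.CoordinateRing) : ℕ :=
  (Associates.mk P.place.asIdeal).count (Associates.mk (Ideal.span {g})).factors

theorem ord_affine (P : C.AffinePoint) {g : C.CoordinateRing} (hg : g ≠ 0) :
    ord (.affine P) (algebraMap _ C.FunctionField g) = P.mult g := by
  rw [ord, HeightOneSpectrum.valuation_of_algebraMap, HeightOneSpectrum.intValuation_if_neg _ hg,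
    WithZero.log_exp, neg_neg]
  rfl

theorem mult_mul (P : C.AffinePoint) {g h : C.CoordinateRing} (hg : g ≠ 0) (hh : h ≠ 0) :
    P.mult (g * h) = P.mult g + P.mult h := by
  rw [AffinePoint.mult, ← Ideal.span_singleton_mul_span_singleton, ← Associates.mk_mul_mk,
    Associates.count_mul (Associates.mk_ne_zero'.mpr hg) (Associates.mk_ne_zero'.mpr hh)
      P.place.associates_irreducible]
  rfl

theorem mem_pow_iff (P : C.AffinePoint) {g : C.CoordinateRing} (hg : g ≠ 0) (n : ℕ) :
    g ∈ P.place.asIdeal ^ n ↔ n ≤ P.mult g := by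
  rw [← Associates.le_singleton_iff, Associates.prime_pow_dvd_iff_le
    (Associates.mk_ne_zero'.mpr hg) P.place.associates_irreducible]
  rfl

open Classical in
theorem mult_X_sub_C (P Q : C.AffinePoint) :
    P.mult (algebraMap k[X] _ (X - Polynomial.C Q.x)) =
      (if P = Q then 1 else 0) + (if P = Q.inv then 1 else 0) := by
  have key : ∀ R : C.AffinePoint, (Associates.mk P.place.asIdeal).count
      (Associates.mk R.place.asIdeal).factors = if P = R then 1 else 0 := by
    intro R
    split_ifs with h
    · subst h
      exact Associates.count_self P.place.associates_irreducible
    · refine Associates.count_eq_zero_of_ne P.place.associates_irreducible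
        R.place.associates_irreducible fun h' => h (place_injective ?_)
      exact associated_iff_eq.1 (Associates.mk_eq_mk_iff_associated.1 h')
  rw [AffinePoint.mult, span_X_sub_C, ← Associates.mk_mul_mk, Associates.count_mul
    (Associates.mk_ne_zero.mpr Q.place.ne_bot) (Associates.mk_ne_zero.mpr Q.inv.place.ne_bot)
      P.place.associates_irreducible, key, key]

end OddHyperellipticCurve
end

noncomputable section

namespace OddHyperellipticCurve

variable {k : Type*} [Field k] {γ : ℕ} {C : OddHyperellipticCurve k γ}

/-! ### Divisors of regular functions -/

theorem conj_mem_pow (P : C.AffinePoint) {g : C.CoordinateRing} {n : ℕ}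
    (hg : g ∈ P.place.asIdeal ^ n) : C.conj g ∈ P.inv.place.asIdeal ^ n := by
  have h := Ideal.mem_map_of_mem C.conj hg
  rw [Ideal.map_pow] at h
  refine Ideal.pow_right_mono (Ideal.map_le_iff_le_comap.2 fun z hz => ?_) n h
  rw [Ideal.mem_comap, mem_place_iff, evalHom_conj, AffinePoint.inv_inv]
  exact hz

theorem conj_ne_zero {g : C.CoordinateRing} (hg : g ≠ 0) : C.conj g ≠ 0 :=
  (map_ne_zero_iff _ C.conj_injective).2 hg

open Classical in
theorem count_map_inv (M : Multiset C.AffinePoint) (P : C.AffinePoint) :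
    (M.map AffinePoint.inv).count P = M.count P.inv := by
  conv_lhs => rw [← AffinePoint.inv_inv P]
  exact Multiset.count_map_eq_count' _ _ AffinePoint.inv_injective _

variable [CharZero k]

/-- The function field is the localization of the coordinate ring at the nonzero polynomials in `x`,
and norms of free extensions commute with localization. -/
theorem ord_infty (g : C.CoordinateRing) :
    ord .infty (algebraMap _ C.FunctionField g) = -((Algebra.norm k[X] g).natDegree : ℤ) := by
  have : IsIntegrallyClosed C.CoordinateRing := C.isIntegrallyClosed_coordinateRing two_ne_zero
  have : IsIntegralClosure C.CoordinateRing k[X] C.FunctionField :=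
    IsIntegralClosure.of_isIntegrallyClosed _ _ _
  have : IsLocalization (Algebra.algebraMapSubmonoid C.CoordinateRing k[X]⁰) C.FunctionField :=
    IsIntegralClosure.isLocalization k[X] (RatFunc k) C.FunctionField C.CoordinateRing
  rw [ord, Algebra.norm_localization k[X] k[X]⁰, RatFunc.intDegree_polynomial]

theorem mult_le_mult_conj (P : C.AffinePoint) {g : C.CoordinateRing} (hg : g ≠ 0) :
    P.mult g ≤ P.inv.mult (C.conj g) :=
  (mem_pow_iff _ (conj_ne_zero hg) _).1 (conj_mem_pow P ((mem_pow_iff P hg _).2 le_rfl))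

theorem mult_conj (P : C.AffinePoint) {g : C.CoordinateRing} (hg : g ≠ 0) :
    P.mult (C.conj g) = P.inv.mult g := by
  apply le_antisymm
  · have h := mult_le_mult_conj P (conj_ne_zero hg)
    rwa [conj_conj] at h
  · have h := mult_le_mult_conj P.inv hg
    rwa [AffinePoint.inv_inv] at h

theorem mult_C (P : C.AffinePoint) {c : k} (hc : c ≠ 0) :
    P.mult (algebraMap k[X] _ (Polynomial.C c)) = 0 := by
  have hne : algebraMap k[X] C.CoordinateRing (Polynomial.C c) ≠ 0 :=
    (map_ne_zero_iff _ (FaithfulSMul.algebraMap_injective _ _)).2 (C_ne_zero.2 hc)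
  by_contra h
  have := (mem_pow_iff P hne 1).2 (Nat.one_le_iff_ne_zero.2 h)
  rw [pow_one, mem_place_iff, evalHom_algebraMap, eval_C] at this
  exact hc this

section

variable [IsAlgClosed k]

omit [CharZero k] in
theorem exists_point (C : OddHyperellipticCurve k γ) (r : k) : ∃ P : C.AffinePoint, P.x = r := by
  obtain ⟨y, hy⟩ := IsAlgClosed.exists_pow_nat_eq (C.f.eval r) two_pos
  exact ⟨⟨r, y, hy⟩, rfl⟩

/-- A point of the affine curve with a given `x`-coordinate. -/
def pointOver (C : OddHyperellipticCurve k γ) (r : k) : C.AffinePoint := (C.exists_point r).choose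

omit [CharZero k] in
theorem pointOver_x (r : k) : (C.pointOver r).x = r := (C.exists_point r).choose_spec

open Classical in
-- Each root contributes a point above it and the conjugate point. The sum is symmetric, so the
-- choice made in `pointOver` is harmless.
theorem mult_algebraMap (P : C.AffinePoint) {a : k[X]} (ha : a ≠ 0) :
    P.mult (algebraMap k[X] _ a) = (a.roots.map C.pointOver).count P +
      (a.roots.map C.pointOver).count P.inv := by
  have hinj := FaithfulSMul.algebraMap_injective k[X] C.CoordinateRing
  have key : ∀ s : Multiset k, P.mult (algebraMap k[X] C.CoordinateRing
      (s.map fun r => X - Polynomial.C r).prod) = (s.map C.pointOver).count P +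
      (s.map C.pointOver).count P.inv := by
    intro s
    induction s using Multiset.induction with
    | empty => simpa using mult_C P (one_ne_zero (α := k))
    | cons r s ih =>
      rw [Multiset.map_cons, Multiset.prod_cons, map_mul, mult_mul, ih, Multiset.map_cons,
        Multiset.count_cons, Multiset.count_cons]
      · conv_lhs => rw [← C.pointOver_x r]
        rw [mult_X_sub_C]
        have : P = (C.pointOver r).inv ↔ P.inv = C.pointOver r :=
          ⟨fun h => by rw [h, AffinePoint.inv_inv], fun h => by rw [← h, AffinePoint.inv_inv]⟩
        simp only [this]
        omega
      · exact (map_ne_zero_iff _ hinj).2 (X_sub_C_ne_zero r)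
      · refine (map_ne_zero_iff _ hinj).2 (Multiset.prod_ne_zero fun h => ?_)
        obtain ⟨r, -, hr⟩ := Multiset.mem_map.1 h
        exact X_sub_C_ne_zero r hr
  conv_lhs => rw [(IsAlgClosed.splits a).eq_prod_roots]
  rw [map_mul, mult_mul, key, mult_C P (leadingCoeff_ne_zero.2 ha), zero_add]
  · exact (map_ne_zero_iff _ hinj).2 (C_ne_zero.2 (leadingCoeff_ne_zero.2 ha))
  · refine (map_ne_zero_iff _ hinj).2 (Multiset.prod_ne_zero fun h => ?_)
    obtain ⟨r, -, hr⟩ := Multiset.mem_map.1 h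
    exact X_sub_C_ne_zero r hr

omit [CharZero k] in
theorem card_roots_map_pointOver (a : k[X]) :
    (a.roots.map C.pointOver).card = a.natDegree := by
  rw [Multiset.card_map, (IsAlgClosed.splits a).natDegree_eq_card_roots]

open Classical in
/-- The affine part of the divisor of zeros of a regular function; its degree is the degree of the
norm. -/
theorem exists_zeros {g : C.CoordinateRing} (hg : g ≠ 0) : ∃ Z : Multiset C.AffinePoint,
    (∀ P, Z.count P = P.mult g) ∧ Z.card = (Algebra.norm k[X] g).natDegree := by
  set S := (Algebra.norm k[X] g).roots.map C.pointOver with hS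
  -- The product of `g` and its conjugate is the norm, a polynomial in `x` whose zeros are known.
  have hsum : ∀ P : C.AffinePoint, P.mult g + P.inv.mult g = S.count P + S.count P.inv := by
    intro P
    rw [hS, ← mult_algebraMap P (norm_ne_zero hg), ← mul_conj, mult_mul P hg (conj_ne_zero hg),
      mult_conj P hg]
  let F : C.AffinePoint →₀ ℕ := Finsupp.onFinset (S + S.map AffinePoint.inv).toFinset
    (fun P => P.mult g) (by
      intro P hP
      rw [Multiset.mem_toFinset, ← Multiset.count_pos, Multiset.count_add, count_map_inv, ← hsum]
      omega)
  have hF : ∀ P, (Finsupp.toMultiset F).count P = P.mult g := fun P => by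
    rw [Finsupp.count_toMultiset]
    rfl
  refine ⟨Finsupp.toMultiset F, hF, ?_⟩
  -- Comparing cardinalities here gives twice the desired equality.
  have h : Finsupp.toMultiset F + (Finsupp.toMultiset F).map AffinePoint.inv =
      S + S.map AffinePoint.inv := by
    ext P
    rw [Multiset.count_add, Multiset.count_add, count_map_inv, count_map_inv, hF, hF, hsum]
  have := congrArg Multiset.card h
  rw [Multiset.card_add, Multiset.card_add, Multiset.card_map, Multiset.card_map AffinePoint.inv S,
    hS, card_roots_map_pointOver] at this
  omega

/-- A nonzero prime contains the norm of one of its nonzero elements. The norm splits over `k`, so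
the prime contains some `x - r`, hence one of the two maximal ideals above `r`. -/
theorem exists_place_eq (v : HeightOneSpectrum C.CoordinateRing) :
    ∃ P : C.AffinePoint, v = P.place := by
  obtain ⟨g, hgv, hg⟩ := Submodule.exists_mem_ne_zero_of_ne_bot v.ne_bot
  have hN : algebraMap k[X] _ (Algebra.norm k[X] g) ∈ v.asIdeal := by
    rw [← mul_conj]
    exact v.asIdeal.mul_mem_right _ hgv
  have hprime := v.isPrime
  obtain ⟨r, hr⟩ : ∃ r : k, algebraMap k[X] _ (X - Polynomial.C r) ∈ v.asIdeal := by
    rw [(IsAlgClosed.splits (Algebra.norm k[X] g)).eq_prod_roots, map_mul] at hN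
    rcases hprime.mem_or_mem hN with h | h
    · refine absurd (Ideal.eq_top_of_isUnit_mem _ h ?_) hprime.ne_top
      exact (isUnit_C.2 (IsUnit.mk0 _ (leadingCoeff_ne_zero.2 (norm_ne_zero hg)))).map _
    · rw [map_multiset_prod] at h
      obtain ⟨z, hz, hzv⟩ := (hprime.multiset_prod_mem_iff_exists_mem _).1 h
      simp only [Multiset.map_map, Multiset.mem_map, Function.comp] at hz
      obtain ⟨r, -, rfl⟩ := hz
      exact ⟨r, hzv⟩
  obtain ⟨P, rfl⟩ := C.exists_point r
  rw [← Ideal.span_singleton_le_iff_mem, span_X_sub_C] at hr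
  rcases hprime.mul_le.1 hr with h | h
  · exact ⟨P, HeightOneSpectrum.ext (P.place.isMaximal.eq_of_le hprime.ne_top h).symm⟩
  · exact ⟨P.inv, HeightOneSpectrum.ext (P.inv.place.isMaximal.eq_of_le hprime.ne_top h).symm⟩

/-- A Dedekind domain is the intersection of its valuation rings, and all its places come from
affine points. -/
theorem exists_eq_algebraMap {h : C.FunctionField} (hh : h ≠ 0)
    (hord : ∀ P : C.AffinePoint, 0 ≤ ord (.affine P) h) :
    ∃ g : C.CoordinateRing, algebraMap _ _ g = h := by
  refine HeightOneSpectrum.mem_integers_of_valuation_le_one _ h fun v => ?_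
  obtain ⟨P, rfl⟩ := exists_place_eq v
  have h1 := hord P
  rw [ord, Left.nonneg_neg_iff] at h1
  have hne : P.place.valuation C.FunctionField h ≠ 0 := (Valuation.ne_zero_iff _).2 hh
  rw [← WithZero.exp_log hne, ← WithZero.exp_zero]
  exact WithZero.exp_le_exp.2 h1

/-! ### Functions with prescribed zeros -/

omit [IsAlgClosed k] in
-- One more order of vanishing costs at most one dimension: successive powers of the maximal ideal
-- have a quotient of dimension one over the residue field `k`.
theorem finrank_inf_pow_le (P : C.AffinePoint) (W : Submodule k C.CoordinateRing)
    [FiniteDimensional k W] (i : ℕ) (hW : ∀ g ∈ W, g ∈ P.place.asIdeal ^ i) :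
    Module.finrank k W ≤
      Module.finrank k ↥(W ⊓ (P.place.asIdeal ^ (i + 1)).restrictScalars k) + 1 := by
  by_cases hle : W ≤ (P.place.asIdeal ^ (i + 1)).restrictScalars k
  · rw [inf_eq_left.2 hle]
    omega
  obtain ⟨a, haW, ha⟩ := SetLike.not_le_iff_exists.1 hle
  have hW' : W ≤ (W ⊓ (P.place.asIdeal ^ (i + 1)).restrictScalars k) ⊔ Submodule.span k {a} := by
    intro c hc
    have := P.place.isPrime
    obtain ⟨d, e, he, hde⟩ := Ideal.exists_mul_add_mem_pow_succ P.place.ne_bot a c (hW a haW) ha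
      (hW c hc)
    -- The coefficient `d` may be replaced by its value at `P`, since the difference vanishes there
    -- and `a` already lies in the `i`-th power.
    have hcd : c - P.evalHom d • a ∈ P.place.asIdeal ^ (i + 1) := by
      have h1 : d - algebraMap k _ (P.evalHom d) ∈ P.place.asIdeal := by
        rw [mem_place_iff, map_sub, evalHom_const, sub_self]
      have h2 : c - P.evalHom d • a = a * (d - algebraMap k _ (P.evalHom d)) + e := by
        rw [← hde, Algebra.smul_def]
        ring
      rw [h2]
      refine Ideal.add_mem _ ?_ he
      rw [pow_succ]
      exact Ideal.mul_mem_mul (hW a haW) h1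
    rw [← sub_add_cancel c (P.evalHom d • a)]
    refine Submodule.add_mem_sup ⟨W.sub_mem hc (W.smul_mem _ haW), hcd⟩ ?_
    exact Submodule.smul_mem _ _ (Submodule.mem_span_singleton_self a)
  have : FiniteDimensional k ↥(W ⊓ (P.place.asIdeal ^ (i + 1)).restrictScalars k) :=
    Submodule.finiteDimensional_of_le inf_le_left
  calc Module.finrank k W ≤ _ := Submodule.finrank_mono hW'
    _ ≤ _ := Submodule.finrank_add_le_finrank_add_finrank _ _
    _ ≤ _ := by
      refine Nat.add_le_add_left ((finrank_span_le_card ({a} : Set C.CoordinateRing)).trans ?_) _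
      simp

open Classical in
omit [IsAlgClosed k] in
theorem exists_submodule_vanishing (V : Submodule k C.CoordinateRing) [FiniteDimensional k V]
    (M : Multiset C.AffinePoint) : ∃ W ≤ V, Module.finrank k V ≤ Module.finrank k W + M.card ∧
      ∀ g ∈ W, ∀ P, g ∈ P.place.asIdeal ^ M.count P := by
  induction M using Multiset.induction with
  | empty => exact ⟨V, le_rfl, by simp, by simp⟩
  | cons Q M ih =>
    obtain ⟨W, hWV, hW, hM⟩ := ih
    have : FiniteDimensional k W := Submodule.finiteDimensional_of_le hWV
    refine ⟨W ⊓ (Q.place.asIdeal ^ (M.count Q + 1)).restrictScalars k, inf_le_left.trans hWV, ?_,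
      fun g hg P => ?_⟩
    · have := finrank_inf_pow_le Q W (M.count Q) fun g hg => hM g hg Q
      rw [Multiset.card_cons]
      omega
    · rw [Multiset.count_cons]
      split_ifs with h
      · subst h
        exact hg.2
      · exact hM g hg.1 P

/-- The functions `a(x) + b y` with `deg a ≤ γ` and `b` constant. -/
def sectionMap (C : OddHyperellipticCurve k γ) :
    (degreeLT k (γ + 1) × k) →ₗ[k] C.CoordinateRing where
  toFun z := C.linY z.1 (Polynomial.C z.2)
  map_add' z w := by
    simp only [linY, Prod.fst_add, Prod.snd_add, Submodule.coe_add, map_add]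
    ring
  map_smul' c z := by
    simp only [linY, Prod.smul_fst, Prod.smul_snd, Submodule.coe_smul, RingHom.id_apply,
      Polynomial.smul_eq_C_mul, smul_eq_mul, map_mul]
    rw [Algebra.smul_def c, IsScalarTower.algebraMap_apply k k[X] C.CoordinateRing,
      Polynomial.algebraMap_eq]
    ring

open Classical in
omit [IsAlgClosed k] in
theorem exists_function_vanishing (M : Multiset C.AffinePoint) (hM : M.card ≤ γ + 1) :
    ∃ g : C.CoordinateRing, g ≠ 0 ∧ (∀ P, M.count P ≤ P.mult g) ∧
      (Algebra.norm k[X] g).natDegree ≤ 2 * γ + 1 := by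
  have hinj : Function.Injective C.sectionMap := by
    rintro ⟨a, b⟩ ⟨a', b'⟩ h
    obtain ⟨h1, h2⟩ := linY_injective h
    exact Prod.ext (Subtype.ext h1) (C_injective h2)
  have : FiniteDimensional k (degreeLT k (γ + 1)) :=
    LinearEquiv.finiteDimensional (degreeLTEquiv k (γ + 1)).symm
  obtain ⟨W, hWV, hW, hg⟩ := exists_submodule_vanishing (LinearMap.range C.sectionMap) M
  -- The dimension is `(γ + 1) + 1`, one more than the largest allowed number of conditions.
  rw [LinearMap.finrank_range_of_inj hinj, Module.finrank_prod,
    (degreeLTEquiv k (γ + 1)).finrank_eq, Module.finrank_fin_fun, Module.finrank_self] at hW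
  have hW0 : W ≠ ⊥ := by
    rintro rfl
    rw [finrank_bot] at hW
    omega
  obtain ⟨g, hgW, hg0⟩ := Submodule.exists_mem_ne_zero_of_ne_bot hW0
  refine ⟨g, hg0, fun P => (mem_pow_iff P hg0 _).1 (hg g hgW P), ?_⟩
  obtain ⟨⟨⟨a, ha⟩, b⟩, rfl⟩ := hWV hgW
  refine natDegree_norm_linY_upper ?_ (natDegree_C b)
  rw [mem_degreeLT, degree_lt_iff_coeff_zero] at ha
  exact natDegree_le_iff_coeff_eq_zero.2 ha

end

end OddHyperellipticCurve
end

noncomputable section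

namespace OddHyperellipticCurve

variable {k : Type*} [Field k] {γ : ℕ} {C : OddHyperellipticCurve k γ}

/-! ### Classes of effective affine divisors -/

/-- The divisor `p₁ + ⋯ + pₙ - n q` of a multiset of affine points. -/
def affineDivisor (M : Multiset C.AffinePoint) : C.DivisorZero :=
  (M.map fun P => C.pointDivisor (.affine P)).sum

theorem affineDivisor_add (M N : Multiset C.AffinePoint) :
    affineDivisor (M + N) = affineDivisor M + affineDivisor N := by
  rw [affineDivisor, Multiset.map_add, Multiset.sum_add]
  rfl

theorem affineDivisor_cons (P : C.AffinePoint) (M : Multiset C.AffinePoint) :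
    affineDivisor (P ::ₘ M) = C.pointDivisor (.affine P) + affineDivisor M := by
  rw [affineDivisor, Multiset.map_cons, Multiset.sum_cons]
  rfl

theorem affineDivisor_zero : affineDivisor (0 : Multiset C.AffinePoint) = 0 := by
  simp [affineDivisor]

open Classical in
theorem affineDivisor_apply_affine (M : Multiset C.AffinePoint) (P : C.AffinePoint) :
    (affineDivisor M : C.Divisor) (.affine P) = M.count P := by
  induction M using Multiset.induction with
  | empty => simp [affineDivisor_zero]
  | cons Q M ih =>
    rw [affineDivisor_cons, AddSubgroup.coe_add, Finsupp.add_apply, ih, pointDivisor,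
      Finsupp.sub_apply, Finsupp.single_apply, Finsupp.single_apply, Multiset.count_cons]
    by_cases h : P = Q
    · subst h
      simp [add_comm]
    · have h' : ¬ Q = P := fun e => h e.symm
      simp [h, h']

theorem affineDivisor_apply_infty (M : Multiset C.AffinePoint) :
    (affineDivisor M : C.Divisor) .infty = -(M.card : ℤ) := by
  induction M using Multiset.induction with
  | empty => simp [affineDivisor_zero]
  | cons Q M ih =>
    rw [affineDivisor_cons, AddSubgroup.coe_add, Finsupp.add_apply, ih, pointDivisor]
    simp

variable [CharZero k]

/-- The class `[p₁ + ⋯ + pₙ - n q]` of a multiset of affine points. -/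
def affineClass (M : Multiset C.AffinePoint) : C.Jac := C.divisorClass (affineDivisor M)

theorem affineClass_zero : affineClass (0 : Multiset C.AffinePoint) = 0 := by
  rw [affineClass, affineDivisor_zero, map_zero]

theorem affineClass_add (M N : Multiset C.AffinePoint) :
    affineClass (M + N) = affineClass M + affineClass N := by
  rw [affineClass, affineDivisor_add, map_add]
  rfl

theorem affineClass_cons (P : C.AffinePoint) (M : Multiset C.AffinePoint) :
    affineClass (P ::ₘ M) = C.pointClass (.affine P) + affineClass M := by
  rw [affineClass, affineDivisor_cons, map_add]
  rfl

theorem affineClass_eq_zero_iff (M : Multiset C.AffinePoint) :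
    affineClass M = 0 ↔ ∃ h : C.FunctionField, h ≠ 0 ∧
      ∀ P, (affineDivisor M : C.Divisor) P = ord P h := by
  rw [affineClass, divisorClass, QuotientAddGroup.mk'_apply, QuotientAddGroup.eq_zero_iff,
    AddSubgroup.mem_addSubgroupOf]
  rfl

open Classical in
theorem affineClass_zeros {g : C.CoordinateRing} (hg : g ≠ 0) {Z : Multiset C.AffinePoint}
    (hZ : ∀ P, Z.count P = P.mult g) (hcard : Z.card = (Algebra.norm k[X] g).natDegree) :
    affineClass Z = 0 := by
  refine (affineClass_eq_zero_iff Z).2 ⟨algebraMap _ _ g,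
    (map_ne_zero_iff _ (IsFractionRing.injective _ _)).2 hg, fun P => ?_⟩
  cases P with
  | affine P => rw [affineDivisor_apply_affine, ord_affine P hg, hZ]
  | infty => rw [affineDivisor_apply_infty, ord_infty, hcard]

/-- The function `x - P.x` has exactly these two zeros, counted with multiplicity, and a double pole
at infinity. -/
theorem pointClass_add_inv (P : C.AffinePoint) :
    C.pointClass (.affine P) + C.pointClass (.affine P.inv) = 0 := by
  classical
  have hne : algebraMap k[X] C.CoordinateRing (X - Polynomial.C P.x) ≠ 0 :=
    (map_ne_zero_iff _ (FaithfulSMul.algebraMap_injective _ _)).2 (X_sub_C_ne_zero _)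
  have h := affineClass_zeros hne (Z := P ::ₘ P.inv ::ₘ 0) (fun Q => by
    rw [mult_X_sub_C, Multiset.count_cons, Multiset.count_cons, Multiset.count_zero]
    omega) (by
    rw [algebraMap_eq_linY, norm_linY, zero_pow two_ne_zero, zero_mul, sub_zero, natDegree_pow,
      natDegree_X_sub_C]
    simp)
  rwa [affineClass_cons, affineClass_cons, affineClass_zero, add_zero] at h

theorem affineClass_map_inv (M : Multiset C.AffinePoint) :
    affineClass (M.map AffinePoint.inv) = -affineClass M := by
  induction M using Multiset.induction with
  | empty => simp [affineClass_zero]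
  | cons P M ih =>
    rw [Multiset.map_cons, affineClass_cons, affineClass_cons, ih,
      eq_neg_of_add_eq_zero_right (pointClass_add_inv P), neg_add]

/-! ### Semireduced multisets: existence and uniqueness of representatives -/

/-- A multiset of affine points is semireduced if it contains no pair of conjugate points. -/
def Semireduced (M : Multiset C.AffinePoint) : Prop := ∀ P, ¬ P ::ₘ P.inv ::ₘ 0 ≤ M

omit [CharZero k] in
theorem Semireduced.mono {M N : Multiset C.AffinePoint} (hN : Semireduced N) (h : M ≤ N) :
    Semireduced M := fun P hP => hN P (hP.trans h)

omit [CharZero k] in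
open Classical in
-- At a Weierstrass point the conjugate pair is a double point, so membership has to be replaced by
-- multiplicity.
theorem pair_le_iff (M : Multiset C.AffinePoint) (P : C.AffinePoint) :
    P ::ₘ P.inv ::ₘ 0 ≤ M ↔ if P.inv = P then 2 ≤ M.count P else P ∈ M ∧ P.inv ∈ M := by
  split_ifs with h
  · rw [h, Multiset.le_count_iff_replicate_le]
    rfl
  · have hnd : (P ::ₘ P.inv ::ₘ 0 : Multiset C.AffinePoint).Nodup := by
      simp only [Multiset.nodup_cons, Multiset.mem_cons, Multiset.notMem_zero, or_false,
        not_false_iff, Multiset.nodup_zero, and_true]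
      exact fun e => h e.symm
    rw [Multiset.le_iff_subset hnd, Multiset.cons_subset, Multiset.cons_subset]
    simp

/-- Conjugate pairs have class zero and can be deleted until none is left. -/
theorem exists_semireduced (M : Multiset C.AffinePoint) :
    ∃ N, Semireduced N ∧ N.card ≤ M.card ∧ affineClass N = affineClass M := by
  classical
  induction hn : M.card using Nat.strong_induction_on generalizing M with
  | _ n ih =>
    by_cases hM : Semireduced M
    · exact ⟨M, hM, hn.le, rfl⟩
    · simp only [Semireduced, not_forall, not_not] at hM
      obtain ⟨P, hP⟩ := hM
      obtain ⟨M', rfl⟩ := Multiset.le_iff_exists_add.1 hP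
      have hcard : M'.card + 2 = n := by
        rw [← hn, Multiset.card_add, Multiset.card_cons, Multiset.card_cons, Multiset.card_zero]
        omega
      obtain ⟨N, h1, h2, h3⟩ := ih M'.card (by omega) M' rfl
      refine ⟨N, h1, by omega, ?_⟩
      rw [h3, affineClass_add, affineClass_cons, affineClass_cons, affineClass_zero, add_zero,
        pointClass_add_inv, zero_add]

section

variable [IsAlgClosed k]

/-- A semireduced divisor is contained in every linearly equivalent effective affine divisor of
small degree. -/
theorem Semireduced.le_of_affineClass_eq {M N : Multiset C.AffinePoint} (hM : Semireduced M)
    (hcard : M.card + N.card ≤ 2 * γ) (h : affineClass M = affineClass N) : M ≤ N := by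
  classical
  have h0 : affineClass (M + N.map AffinePoint.inv) = 0 := by
    rw [affineClass_add, affineClass_map_inv, h, add_neg_cancel]
  obtain ⟨z, hz, hord⟩ := (affineClass_eq_zero_iff _).1 h0
  obtain ⟨g, rfl⟩ := exists_eq_algebraMap hz fun P => by
    rw [← hord, affineDivisor_apply_affine]
    exact Int.natCast_nonneg _
  have hg : g ≠ 0 := by
    rintro rfl
    exact hz (map_zero _)
  obtain ⟨a, b, rfl⟩ := C.exists_eq_add_mul_yFun g
  change C.linY a b ≠ 0 at hg
  change ∀ P, _ = ord P (algebraMap _ _ (C.linY a b)) at hord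
  -- The pole order at infinity is at most `2γ`, too small for a function that involves `y`.
  have hb : b = 0 := by
    by_contra hb
    have h1 := natDegree_norm_linY_lower (C := C) a b hb
    have h2 := hord .infty
    rw [affineDivisor_apply_infty, ord_infty, Multiset.card_add, Multiset.card_map] at h2
    omega
  subst hb
  have ha : a ≠ 0 := fun ha => hg (linY_eq_zero_iff.2 ⟨ha, rfl⟩)
  have hcount : ∀ P : C.AffinePoint, M.count P + N.count P.inv =
      (a.roots.map C.pointOver).count P + (a.roots.map C.pointOver).count P.inv := by
    intro P
    have h1 := hord (.affine P)
    rw [affineDivisor_apply_affine, ord_affine P hg, ← algebraMap_eq_linY, mult_algebraMap P ha,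
      Multiset.count_add, count_map_inv] at h1
    exact_mod_cast h1
  rw [Multiset.le_iff_count]
  intro P
  have hp := hM P
  have h1 := hcount P
  have h2 := hcount P.inv
  rw [AffinePoint.inv_inv] at h2
  rw [pair_le_iff] at hp
  split_ifs at hp with hP
  -- At a Weierstrass point `h1` says that the two multiplicities have an even sum. That of `M` is
  -- at most one, so if it is one then that of `N` is odd.
  · rw [hP] at h1
    omega
  -- If `P` occurs in `M` then its conjugate does not, and the equal right sides of `h1` and `h2`
  -- bound the multiplicity in `M` by that in `N`.
  · rw [← Multiset.one_le_count_iff_mem, ← Multiset.one_le_count_iff_mem] at hp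
    omega

theorem Semireduced.eq_of_affineClass_eq {M N : Multiset C.AffinePoint} (hM : Semireduced M)
    (hN : Semireduced N) (hcard : M.card + N.card ≤ 2 * γ) (h : affineClass M = affineClass N) :
    M = N :=
  le_antisymm (hM.le_of_affineClass_eq hcard h) (hN.le_of_affineClass_eq (by omega) h.symm)

/-- With `γ + 1` points, the residual zeros of a function through `M` have class opposite to that of
`M`; conjugating them restores the sign. With fewer points, deleting conjugate pairs suffices. -/
theorem exists_reduction {M : Multiset C.AffinePoint} (hM : M.card ≤ γ + 1) :
    ∃ N, Semireduced N ∧ N.card ≤ γ ∧ affineClass N = affineClass M := by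
  classical
  rcases hM.lt_or_eq with hlt | heq
  · obtain ⟨N, h1, h2, h3⟩ := exists_semireduced M
    exact ⟨N, h1, by omega, h3⟩
  obtain ⟨g, hg, hgM, hdeg⟩ := exists_function_vanishing M hM
  obtain ⟨Z, hZ, hcard⟩ := exists_zeros hg
  have hle : M ≤ Z := Multiset.le_iff_count.2 fun P => by
    rw [hZ]
    exact hgM P
  obtain ⟨Z', rfl⟩ := Multiset.le_iff_exists_add.1 hle
  have h0 := affineClass_zeros hg hZ hcard
  rw [Multiset.card_add] at hcard
  obtain ⟨N, h1, h2, h3⟩ := exists_semireduced (Z'.map AffinePoint.inv)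
  refine ⟨N, h1, ?_, ?_⟩
  · rw [Multiset.card_map] at h2
    omega
  · rw [h3, affineClass_map_inv]
    rw [affineClass_add] at h0
    exact (eq_neg_of_add_eq_zero_left h0).symm

/-- Every multiple of a point class has a reduced representative. -/
theorem exists_reduced_nsmul (P : C.AffinePoint) (j : ℕ) :
    ∃ M, Semireduced M ∧ M.card ≤ γ ∧ affineClass M = j • C.pointClass (.affine P) := by
  induction j with
  | zero =>
    refine ⟨0, fun Q hQ => ?_, by simp, by rw [affineClass_zero]; exact (zero_nsmul _).symm⟩
    have := Multiset.card_le_card hQ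
    simp at this
  | succ j ih =>
    obtain ⟨M, -, h2, h3⟩ := ih
    obtain ⟨N, k1, k2, k3⟩ := exists_reduction (M := P ::ₘ M) (by rw [Multiset.card_cons]; omega)
    refine ⟨N, k1, k2, ?_⟩
    rw [k3, affineClass_cons, h3, succ_nsmul, add_comm]

/-! ### Theta strata -/

omit [IsAlgClosed k] in
theorem pointClass_infty : C.pointClass .infty = 0 := by
  have : C.pointDivisor .infty = 0 := Subtype.ext (sub_self _)
  rw [pointClass, this, map_zero]

omit [IsAlgClosed k] in
theorem abelJacobi_eq_sum (d : ℕ) (P : Fin d → C.Point) :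
    C.abelJacobi d P = ∑ i, C.pointClass (P i) := by
  rw [abelJacobi, map_sum]
  rfl

omit [IsAlgClosed k] in
-- Entries of the tuple equal to the point at infinity have class zero, which turns exactly `d`
-- points into at most `d` affine ones.
theorem mem_Theta_iff (x : C.Jac) (d : ℕ) :
    x ∈ C.Theta d ↔ ∃ M : Multiset C.AffinePoint, M.card ≤ d ∧ affineClass M = x := by
  constructor
  · rintro ⟨P, rfl⟩
    rw [abelJacobi_eq_sum]
    induction d with
    | zero => exact ⟨0, le_rfl, by simp [affineClass_zero]⟩
    | succ d ih =>
      obtain ⟨M, h1, h2⟩ := ih (fun i => P i.succ)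
      rw [Fin.sum_univ_succ]
      cases P 0 with
      | affine Q =>
        exact ⟨Q ::ₘ M, by rw [Multiset.card_cons]; omega, by rw [affineClass_cons, h2]⟩
      | infty => exact ⟨M, by omega, by rw [pointClass_infty, zero_add, h2]⟩
  · rintro ⟨M, h1, rfl⟩
    suffices h : ∃ P : Fin d → C.Point, ∑ i, C.pointClass (P i) = affineClass M by
      obtain ⟨P, hP⟩ := h
      exact ⟨P, by rw [abelJacobi_eq_sum, hP]⟩
    induction d generalizing M with
    | zero =>
      rw [Nat.le_zero, Multiset.card_eq_zero] at h1
      subst h1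
      exact ⟨fun _ => .infty, by simp [affineClass_zero]⟩
    | succ d ih =>
      induction M using Multiset.induction with
      | empty => exact ⟨fun _ => .infty, by simp [pointClass_infty, affineClass_zero]⟩
      | cons Q M _ =>
        rw [Multiset.card_cons] at h1
        obtain ⟨P, hP⟩ := ih M (by omega)
        refine ⟨Fin.cons (.affine Q) P, ?_⟩
        rw [Fin.sum_univ_succ, affineClass_cons]
        simp only [Fin.cons_zero, Fin.cons_succ, hP]

/-- A representative with fewer points would have to contain `M`. -/
theorem Semireduced.mem_Theta_iff {M : Multiset C.AffinePoint} (hM : Semireduced M)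
    (hcard : M.card ≤ γ) (d : ℕ) : affineClass M ∈ C.Theta d ↔ M.card ≤ d := by
  rw [OddHyperellipticCurve.mem_Theta_iff]
  refine ⟨fun ⟨N, h1, h2⟩ => ?_, fun h => ⟨M, h, rfl⟩⟩
  by_contra! h
  have := Multiset.card_le_card (hM.le_of_affineClass_eq (by omega) h2.symm)
  omega

theorem Semireduced.mem_ThetaOpen_iff {M : Multiset C.AffinePoint} (hM : Semireduced M)
    (hcard : M.card ≤ γ) (d : ℕ) : affineClass M ∈ C.ThetaOpen d ↔ d = M.card := by
  cases d with
  | zero =>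
    rw [ThetaOpen, hM.mem_Theta_iff hcard]
    omega
  | succ d =>
    rw [ThetaOpen, Set.mem_sdiff, hM.mem_Theta_iff hcard, hM.mem_Theta_iff hcard]
    omega

theorem Semireduced.multProfile_eq {M : Multiset C.AffinePoint} (hM : Semireduced M)
    (hcard : M.card ≤ γ) {x : C.Jac} {j : ℕ} (h : affineClass M = j • x) :
    C.multProfile x j = M.card := by
  have : {d | j • x ∈ C.ThetaOpen d} = {M.card} := by
    ext d
    rw [Set.mem_ofPred_eq, ← h, hM.mem_ThetaOpen_iff hcard, Set.mem_singleton_iff]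
  rw [multProfile, this, csInf_singleton]

/-! ### Reduced divisors -/

omit [CharZero k] [IsAlgClosed k] in
theorem iota_affine (P : C.AffinePoint) : C.iota (.affine P) = .affine P.inv := rfl

omit [CharZero k] [IsAlgClosed k] in
theorem coe_affineDivisor_ofFn {n : ℕ} (P : Fin n → C.AffinePoint) :
    (affineDivisor (Multiset.ofList (List.ofFn P)) : C.Divisor) =
      ∑ i, Finsupp.single (Point.affine (P i)) 1 - Finsupp.single .infty (n : ℤ) := by
  rw [affineDivisor, Multiset.map_coe, Multiset.sum_coe, List.map_ofFn, List.sum_ofFn,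
    AddSubgroup.val_finsetSum]
  simp [pointDivisor, Finset.sum_sub_distrib]

omit [CharZero k] [IsAlgClosed k] in
-- Distinct indices may carry the same point, so the indexed condition also excludes double
-- Weierstrass points.
theorem semireduced_ofFn_iff {n : ℕ} (P : Fin n → C.AffinePoint) :
    Semireduced (Multiset.ofList (List.ofFn P)) ↔ ∀ i j, i ≠ j → P j ≠ (P i).inv := by
  classical
  rw [← Fin.univ_val_map]
  constructor
  · intro h i j hij hP
    refine h (P i) ?_
    have hle : i ::ₘ j ::ₘ 0 ≤ (Finset.univ : Finset (Fin n)).val :=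
      (Multiset.le_iff_subset (by simpa using hij)).2 fun _ _ => Finset.mem_univ_val _
    simpa [hP] using Multiset.map_le_map (f := P) hle
  · intro h Q hQ
    rw [pair_le_iff] at hQ
    split_ifs at hQ with hinv
    · rw [Multiset.count_map] at hQ
      obtain ⟨i, hi, j, hj, hij⟩ := Finset.one_lt_card.1
        (show 1 < (Finset.univ.filter fun i => Q = P i).card from hQ)
      rw [Finset.mem_filter] at hi hj
      exact h i j hij (by rw [← hi.2, ← hj.2, hinv])
    · obtain ⟨h1, h2⟩ := hQ
      obtain ⟨i, -, rfl⟩ := Multiset.mem_map.1 h1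
      obtain ⟨j, -, hj⟩ := Multiset.mem_map.1 h2
      refine h i j ?_ hj
      rintro rfl
      exact hinv hj.symm

omit [CharZero k] [IsAlgClosed k] in
theorem isReduced_iff (D : C.DivisorZero) :
    C.IsReduced D ↔ ∃ M, Semireduced M ∧ M.card ≤ γ ∧ D = affineDivisor M := by
  constructor
  · rintro ⟨n, P, hD, hinf, hP, hn⟩
    have : ∀ i, ∃ Q, P i = .affine Q := fun i => by
      cases h : P i with
      | affine Q => exact ⟨Q, rfl⟩
      | infty => exact absurd h (hinf i)
    choose Q hQ using this
    obtain rfl : P = fun i => .affine (Q i) := funext hQ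
    refine ⟨Multiset.ofList (List.ofFn Q), (semireduced_ofFn_iff Q).2 fun i j hij h => ?_,
      by simpa using hn, Subtype.ext ?_⟩
    · exact hP i j hij (congrArg Point.affine h)
    · rw [coe_affineDivisor_ofFn, hD]
  · rintro ⟨M, hM, hcard, rfl⟩
    obtain ⟨l, rfl⟩ : ∃ l : List C.AffinePoint, M = Multiset.ofList l := ⟨M.toList, by simp⟩
    rw [← List.ofFn_get l] at hM ⊢
    refine ⟨l.length, fun i => .affine (l.get i), coe_affineDivisor_ofFn _, by simp,
      fun i j hij h => ?_, by simpa using hcard⟩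
    rw [iota_affine] at h
    exact (semireduced_ofFn_iff _).1 hM i j hij (Point.affine.inj h)

theorem Semireduced.isReduced_and_iff {M : Multiset C.AffinePoint} (hM : Semireduced M)
    (hcard : M.card ≤ γ) (D : C.DivisorZero) :
    C.IsReduced D ∧ C.divisorClass D = affineClass M ↔ D = affineDivisor M := by
  rw [isReduced_iff]
  constructor
  · rintro ⟨⟨N, h1, h2, rfl⟩, h3⟩
    rw [h1.eq_of_affineClass_eq hM (by omega) h3]
  · rintro rfl
    exact ⟨⟨M, hM, hcard, rfl⟩, rfl⟩

/-! ### The step from `j [p - q]` to `(j + 1) [p - q]` -/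

omit [CharZero k] [IsAlgClosed k] in
theorem Semireduced.cons {M : Multiset C.AffinePoint} (hM : Semireduced M) {P : C.AffinePoint}
    (hP : P.inv ∉ M) : Semireduced (P ::ₘ M) := by
  classical
  intro Q hQ
  have h := hM Q
  rw [pair_le_iff] at h hQ
  split_ifs at h hQ with hQi
  · rw [Multiset.count_cons] at hQ
    split_ifs at hQ with hQP
    · subst hQP
      rw [hQi, ← Multiset.one_le_count_iff_mem] at hP
      omega
    · exact h hQ
  · rw [Multiset.mem_cons, Multiset.mem_cons] at hQ
    obtain ⟨rfl | h1, h2 | h2⟩ := hQ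
    · exact hQi h2
    · exact hP h2
    · exact hP (by rwa [← h2, AffinePoint.inv_inv])
    · exact h ⟨h1, h2⟩

open Classical in
theorem card_step_of_mem {M M' : Multiset C.AffinePoint} {P : C.AffinePoint}
    (hM : Semireduced M) (hM' : Semireduced M') (hcard : M.card ≤ γ) (hcard' : M'.card ≤ γ)
    (h : affineClass M' = C.pointClass (.affine P) + affineClass M) (hP : P.inv ∈ M) :
    M'.card + 1 = M.card := by
  obtain ⟨N, rfl⟩ := Multiset.exists_cons_of_mem hP
  rw [affineClass_cons, ← add_assoc, pointClass_add_inv, zero_add] at h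
  rw [Multiset.card_cons] at hcard ⊢
  rw [hM'.eq_of_affineClass_eq (hM.mono (Multiset.le_cons_self _ _)) (by omega) h]

/-- Strictness of `M.card < γ` leaves room for `P`: the two cardinalities still add up to at most
`2γ`, so uniqueness applies. -/
theorem eq_cons_of_notMem {M M' : Multiset C.AffinePoint} {P : C.AffinePoint}
    (hM : Semireduced M) (hM' : Semireduced M') (hcard : M.card < γ) (hcard' : M'.card ≤ γ)
    (h : affineClass M' = C.pointClass (.affine P) + affineClass M) (hP : P.inv ∉ M) :
    M' = P ::ₘ M := by
  rw [← affineClass_cons] at h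
  exact hM'.eq_of_affineClass_eq (hM.cons hP) (by rw [Multiset.card_cons]; omega) h

/-- Here `P ::ₘ M` is semireduced with `γ + 1` points. An equivalent `M'` with at most `γ - 1`
points would fall under the `2γ` bound and have to contain it. -/
theorem card_step_of_card_eq {M M' : Multiset C.AffinePoint} {P : C.AffinePoint}
    (hM : Semireduced M) (hcard : M.card = γ) (hcard' : M'.card ≤ γ)
    (h : affineClass M' = C.pointClass (.affine P) + affineClass M) (hP : P.inv ∉ M) :
    M'.card = γ := by
  rw [← affineClass_cons] at h
  by_contra hne
  have hle := Multiset.card_le_card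
    ((hM.cons hP).le_of_affineClass_eq (by rw [Multiset.card_cons]; omega) h.symm)
  rw [Multiset.card_cons] at hle
  omega

end

end OddHyperellipticCurve
end

/-! ### The multiplication profile of a point class -/

theorem corollary4p4 {k : Type*} [Field k] [IsAlgClosed k] [CharZero k] {γ : ℕ} (hγ : 2 ≤ γ)
    (C : OddHyperellipticCurve k γ) (p : C.Point) (hp : p ≠ .infty) :
    -- the entries of the profile of `[p - q]` are well defined
    (∀ j, 1 ≤ j → ∀ d, j • C.pointClass p ∈ C.ThetaOpen d ↔
      d = C.multProfile (C.pointClass p) j) ∧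
    -- `j [p - q]` has a unique reduced representative, and the profile drops after the index `j`
    -- if and only if `ι(p)` lies in the support of that representative
    (∀ j, 1 ≤ j → ∃ R : C.DivisorZero,
      (∀ D : C.DivisorZero,
        C.IsReduced D ∧ C.divisorClass D = j • C.pointClass p ↔ D = R) ∧
      (C.multProfile (C.pointClass p) (j + 1) < C.multProfile (C.pointClass p) j ↔
        C.iota p ∈ (R : C.Divisor).support)) ∧
    (∀ j, 1 ≤ j → |(C.multProfile (C.pointClass p) j : ℤ) -
      (C.multProfile (C.pointClass p) (j + 1) : ℤ)| ≤ 1) ∧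
    (∀ j, 1 ≤ j → C.multProfile (C.pointClass p) j < γ →
      C.multProfile (C.pointClass p) j ≠ C.multProfile (C.pointClass p) (j + 1)) ∧
    (∀ j, 1 ≤ j →
      C.multProfile (C.pointClass p) (j + 1) = C.multProfile (C.pointClass p) j + 1 →
      C.multProfile (C.pointClass p) (j + 1) = C.multProfile (C.pointClass p) (j + 2) + 1 →
      C.multProfile (C.pointClass p) j = 0 ∧ C.multProfile (C.pointClass p) 2 = 0) := by
  classical
  cases p with
  | infty => exact absurd rfl hp
  | affine P =>
  set x := C.pointClass (.affine P) with hx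
  choose M hM hcard hclass using OddHyperellipticCurve.exists_reduced_nsmul P
  have hprofile : ∀ j, C.multProfile x j = (M j).card := fun j =>
    (hM j).multProfile_eq (hcard j) (hclass j)
  have hstep : ∀ j, OddHyperellipticCurve.affineClass (M (j + 1)) =
      C.pointClass (.affine P) + OddHyperellipticCurve.affineClass (M j) := fun j => by
    rw [hclass, hclass, succ_nsmul, add_comm]
  have hmem : ∀ j, P.inv ∈ M j → (M (j + 1)).card + 1 = (M j).card := fun j =>
    OddHyperellipticCurve.card_step_of_mem (hM j) (hM (j + 1)) (hcard j) (hcard (j + 1)) (hstep j)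
  have hnot : ∀ j, P.inv ∉ M j → (M j).card < γ → M (j + 1) = P ::ₘ M j := fun j h hlt =>
    OddHyperellipticCurve.eq_cons_of_notMem (hM j) (hM (j + 1)) hlt (hcard (j + 1)) (hstep j) h
  have hfull : ∀ j, P.inv ∉ M j → (M j).card = γ → (M (j + 1)).card = γ := fun j h heq =>
    OddHyperellipticCurve.card_step_of_card_eq (hM j) heq (hcard (j + 1)) (hstep j) h
  -- This trichotomy (drop, rise, or plateau at height `γ`) settles the first three numbered claims
  -- by arithmetic.
  have hcases : ∀ j, (P.inv ∈ M j ∧ (M (j + 1)).card + 1 = (M j).card) ∨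
      (P.inv ∉ M j ∧ (M j).card < γ ∧ (M (j + 1)).card = (M j).card + 1) ∨
      (P.inv ∉ M j ∧ (M j).card = γ ∧ (M (j + 1)).card = γ) := by
    intro j
    by_cases h : P.inv ∈ M j
    · exact Or.inl ⟨h, hmem j h⟩
    · rcases (hcard j).lt_or_eq with hlt | heq
      · exact Or.inr (Or.inl ⟨h, hlt, by rw [hnot j h hlt, Multiset.card_cons]⟩)
      · exact Or.inr (Or.inr ⟨h, heq, hfull j h heq⟩)
  simp only [hprofile]
  refine ⟨fun j _ d => ?_, fun j _ => ⟨OddHyperellipticCurve.affineDivisor (M j), fun D => ?_, ?_⟩,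
    fun j _ => ?_, fun j _ => ?_, fun j _ h1 h2 => ?_⟩
  · rw [← hclass, (hM j).mem_ThetaOpen_iff (hcard j)]
  · rw [← hclass, (hM j).isReduced_and_iff (hcard j)]
  · rw [Finsupp.mem_support_iff, OddHyperellipticCurve.iota_affine,
      OddHyperellipticCurve.affineDivisor_apply_affine, Nat.cast_ne_zero, Multiset.count_ne_zero]
    rcases hcases j with ⟨h, h'⟩ | ⟨h, h', h''⟩ | ⟨h, h', h''⟩
    · exact iff_of_true (by omega) h
    · exact iff_of_false (by omega) h
    · exact iff_of_false (by omega) h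
  · rw [abs_le]
    rcases hcases j with h | h | h <;> omega
  · intro hlt
    rcases hcases j with h | h | h <;> omega
  · change (M (j + 1)).card = (M (j + 1 + 1)).card + 1 at h2
    obtain ⟨hj, hlt⟩ : P.inv ∉ M j ∧ (M j).card < γ := by
      rcases hcases j with h | h | h
      · omega
      · exact ⟨h.1, h.2.1⟩
      · omega
    have hj1 : P.inv ∈ M (j + 1) := by
      rcases hcases (j + 1) with h | h | h
      · exact h.1
      · omega
      · omega
    rw [hnot j hj hlt, Multiset.mem_cons] at hj1
    -- The only new point is `P` itself, so `P` is a Weierstrass point and its class is killed by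
    -- two.
    have hinv : P.inv = P := hj1.resolve_right hj
    have h0 : (M 0) = 0 := (hM 0).eq_of_affineClass_eq
      (fun Q hQ => by simpa using Multiset.card_le_card hQ) (by have := hcard 0; simp; omega)
      (by rw [hclass, OddHyperellipticCurve.affineClass_zero]; exact zero_nsmul _)
    have hper : ∀ i, M (i + 2) = M i := fun i => by
      refine (hM _).eq_of_affineClass_eq (hM i) (by have := hcard (i + 2); have := hcard i; omega) ?_
      have h := OddHyperellipticCurve.pointClass_add_inv P
      rw [hinv] at h
      rw [hstep (i + 1), hstep i, ← add_assoc, h, zero_add]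
    have h20 : (M 2).card = 0 := by rw [hper 0, h0, Multiset.card_zero]
    refine ⟨?_, h20⟩
    have hone : (M 1).card = 1 := by
      rw [hnot 0 (by simp [h0]) (by simp [h0]; omega), h0]
      simp
    have hparity : ∀ i, (M (2 * i)).card = 0 ∧ (M (2 * i + 1)).card = 1 := by
      intro i
      induction i with
      | zero => exact ⟨by simp [h0], hone⟩
      | succ i ih => exact ⟨by rw [mul_add, mul_one, hper]; exact ih.1,
          by rw [mul_add, mul_one, add_right_comm, hper]; exact ih.2⟩
    rcases Nat.even_or_odd' j with ⟨i, rfl | rfl⟩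
    · exact (hparity i).1
    -- An odd `j` would give a drop from one to zero, against the assumed rise `h1`.
    · have e1 := (hparity i).2
      have e2 := (hparity (i + 1)).1
      rw [show 2 * (i + 1) = 2 * i + 1 + 1 by ring] at e2
      omega
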